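/- Let $f_0$ be a norm on $\mathbb{R}^n$ and let $x^\star\in\mathbb{R}^n$. For $h:\mathbb{R}^n\to\mathbb{R}$ write $\partial h(z)=\{u: h(z+t)\ge h(z)+\langle u,t\rangle\ \text{for all } t\in\mathbb{R}^n\}$ for the subdifferential and $D(h,z)=\{d:\exists\,a>0,\ h(z+a d)\le h(z)\}$ for the descent cone of $h$ at $z$, and let $\mathrm{ri}$ denote the relative interior. Assume that $\partial f_0(x^\star)$ is non-empty, compact and does not contain the origin (so that $x^\star\neq 0$), and that $$\mathrm{ri}\big(D(f_0,x^\star)\big)\cap \mathrm{ri}\big(D(\|\cdot\|_2,x^\star)\big)\neq\emptyset .$$ Let $$C_1=\{u\in\mathbb{R}^n:\exists\,t>0,\ f_0(x^\star+tu)\le f_0(x^\star)\ \text{and}\ \|x^\star+tu\|_2\le\|x^\star\|_2\}$$ be the prior restricted cone of the problem $\min f_0(x)$ subject to $y=Ax$, $\|x\|_2\le\|x^\star\|_2$, let $$\delta(C_1)=\mathbb{E}\Big(\sup_{t\in C_1,\ \|t\|_2\le 1}\langle g,t\rangle\Big)^2,\qquad g\sim N(0,I_n),$$ be its statistical dimension,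 and for $\tau=(\tau_0,\tau_1)$ with $\tau_0,\tau_1\ge 0$ let $$J_1(\tau)=\mathbb{E}\,\mathrm{dist}^2\Big(g,\ \tau_0\,\partial f_0(x^\star)+\tau_1\frac{x^\star}{\|x^\star\|_2}\Big).$$ Then $$0\le \inf_{\tau_0,\tau_1\ge 0}J_1(\tau)-\delta(C_1)\le \frac{2\sup\{\|s\|_2: s\in\partial f_0(x^\star)\}}{f_0\big(x^\star/\|x^\star\|_2\big)}+\frac12 .$$ -/

import Mathlib

open scoped Pointwise

noncomputable section

/-- The subdifferential of `h` at `z`. -/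
def subdifferential {n : ℕ} (h : EuclideanSpace ℝ (Fin n) → ℝ) (z : EuclideanSpace ℝ (Fin n)) :
    Set (EuclideanSpace ℝ (Fin n)) :=
  {u | ∀ t, h z + inner ℝ u t ≤ h (z + t)}

/-- The descent cone of `h` at `z`: the set of all non-ascent directions of `h` at `z`. -/
def descentCone {n : ℕ} (h : EuclideanSpace ℝ (Fin n) → ℝ) (z : EuclideanSpace ℝ (Fin n)) :
    Set (EuclideanSpace ℝ (Fin n)) :=
  {d | ∃ a : ℝ, 0 < a ∧ h (z + a • d) ≤ h z}

/-- The prior restricted cone, at the true signal `xs`, of the program that minimizes `f 0 x`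
subject to `y = A x` and `f i x ≤ f i xs` for `1 ≤ i ≤ k`. -/
def priorRestrictedCone {n k : ℕ} (f : Fin (k + 1) → EuclideanSpace ℝ (Fin n) → ℝ)
    (xs : EuclideanSpace ℝ (Fin n)) : Set (EuclideanSpace ℝ (Fin n)) :=
  {u | ∃ t : ℝ, 0 < t ∧ ∀ i, f i (xs + t • u) ≤ f i xs}

/-- The statistical dimension of a convex cone `K`: the expectation of the square of
`sup {⟪g, t⟫ : t ∈ K, ‖t‖ ≤ 1}` for a standard Gaussian vector `g`. -/
def statisticalDimension {n : ℕ} (K : Set (EuclideanSpace ℝ (Fin n))) : ℝ :=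
  ∫ g, (sSup ((fun t => inner ℝ g t) '' (K ∩ Metric.closedBall 0 1))) ^ 2
    ∂(ProbabilityTheory.stdGaussian (EuclideanSpace ℝ (Fin n)))

/-- The prior restricted cone of the program that minimizes `f₀ x` subject to `y = A x` and
`‖x‖ ≤ ‖xs‖` (Euclidean norm). -/
def l2PriorRestrictedCone {n : ℕ} (f₀ : EuclideanSpace ℝ (Fin n) → ℝ)
    (xs : EuclideanSpace ℝ (Fin n)) : Set (EuclideanSpace ℝ (Fin n)) :=
  priorRestrictedCone (k := 1) ![f₀, fun x => ‖x‖] xs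

/-- The expected squared distance of a standard Gaussian vector to the set
`τ₀ • ∂f₀(xs) + τ₁ • xs / ‖xs‖`. -/
def l2RecipeObjective {n : ℕ} (f₀ : EuclideanSpace ℝ (Fin n) → ℝ)
    (xs : EuclideanSpace ℝ (Fin n)) (τ : Fin 2 → ℝ) : ℝ :=
  ∫ g, (Metric.infDist g (τ 0 • subdifferential f₀ xs + {τ 1 • (‖xs‖⁻¹ • xs)})) ^ 2
    ∂(ProbabilityTheory.stdGaussian (EuclideanSpace ℝ (Fin n)))

end

/-! Write S = ∂f₀(x⋆), e = x⋆/‖x⋆‖, c = f₀(e), R = sup of ‖s‖ over S. Directions in C₁ pair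
nonpositively with S and with e, so ⟨g, t⟩ ≤ ⟨g - y, t⟩ for y ∈ τ₀S + τ₁e. Hence the supremum over
C₁ is at most the distance, which gives the lower bound (`coneSup_le_infDist`).

For the upper bound τ = (a₀, 0) suffices. Homogeneity of f₀ forces ⟨s, e⟩ = c for every s ∈ S, so
the projection Pg of g onto cone(S) lies in a(g)S with a(g) = ⟨Pg, e⟩/c, which is 1/c-Lipschitz.
Take a₀ = E a. Freezing the dilation at its mean gives dist²(g, a₀S) ≤ dist²(g, cone S) + 2σ(g)(a(g)
- a₀), where σ(g), the support function of S at the residual of g from a₀S, is R-Lipschitz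
(`norm_residual_sq_le_of_isConvexProj_smul`). The last term has mean 2 Cov(σ, a) ≤ 2R/c by the
Gaussian Poincaré inequality (`integral_mul_sub_integral_stdGaussian_le`). Passing from cone(S) +
ℝ₊e to cone(S) costs at most E⟨e, g⟩₊² = 1/2 (`norm_residual_sq_le_add_max_inner_sq`), and the
distance to cone(S) + ℝ₊e is at most the supremum over C₁ (`norm_residual_le_coneSup`). -/

open MeasureTheory ProbabilityTheory Filter Topology
open scoped ENNReal NNReal RealInnerProductSpace

/-! ### Gaussian increments under halving of the squared scale -/

section GaussianPoincare

variable {E : Type*} [NormedAddCommGroup E] [InnerProductSpace ℝ E] [FiniteDimensional ℝ E]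
  [MeasurableSpace E] [BorelSpace E]

lemma lintegral_rotation_stdGaussian {a b : ℝ} (hab : a ^ 2 + b ^ 2 = 1) {H : E × E → ℝ≥0∞}
    (hH : Measurable H) :
    ∫⁻ u, ∫⁻ v, H (a • u + b • v, -b • u + a • v) ∂(stdGaussian E) ∂(stdGaussian E) =
      ∫⁻ u, ∫⁻ v, H (u, v) ∂(stdGaussian E) ∂(stdGaussian E) := by
  obtain ⟨θ, hθ⟩ : ∃ θ : ℝ, Real.cos θ = a ∧ Real.sin θ = b := by
    have hz : ‖(⟨a, b⟩ : ℂ)‖ = 1 := by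
      rw [Complex.norm_def, Complex.normSq_mk, ← pow_two, ← pow_two, hab, Real.sqrt_one]
    obtain ⟨θ, hθ⟩ := (Complex.norm_eq_one_iff _).1 hz
    refine ⟨θ, ?_, ?_⟩
    · rw [← Complex.exp_ofReal_mul_I_re, hθ]
    · rw [← Complex.exp_ofReal_mul_I_im, hθ]
  obtain ⟨rfl, rfl⟩ := hθ
  have hrot := IsGaussian.map_rotation_eq_self (μ := stdGaussian E) (by simp) θ
  rw [← lintegral_prod (fun z : E × E ↦ H z) hH.aemeasurable]
  conv_rhs => rw [← hrot]
  rw [lintegral_map hH (by fun_prop), lintegral_prod]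
  · rfl
  · exact (hH.comp (ContinuousLinearMap.rotation θ).continuous.measurable).aemeasurable

lemma lintegral_linearCombination_stdGaussian {a b : ℝ} (hab : a ^ 2 + b ^ 2 = 1) {H : E → ℝ≥0∞}
    (hH : Measurable H) :
    ∫⁻ u, ∫⁻ v, H (a • u + b • v) ∂(stdGaussian E) ∂(stdGaussian E) =
      ∫⁻ u, H u ∂(stdGaussian E) := by
  have := lintegral_rotation_stdGaussian hab (H := fun z : E × E ↦ H z.1) (by fun_prop)
  simpa using this

/-- The mean squared increment of `f` between two standard Gaussian vectors at correlation
`1 - 2 * b ^ 2`. -/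
noncomputable def gaussianIncrement (f : E → ℝ) (b : ℝ) : ℝ≥0∞ :=
  ∫⁻ u, ∫⁻ v, ENNReal.ofReal ((f (√(1 - b ^ 2) • u + b • v) - f (√(1 - b ^ 2) • u - b • v)) ^ 2)
    ∂(stdGaussian E) ∂(stdGaussian E)

/-- The centre a • u + c • w has the law of √(1 - b²) times a standard Gaussian and is independent
of v. This computes the sides of the quadrilateral used below. -/
lemma lintegral_gaussianIncrement {f : E → ℝ} (hf : Measurable f) {a b c : ℝ}
    (hc : a ^ 2 + c ^ 2 = 1 - b ^ 2) (hb : b ^ 2 < 1) :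
    ∫⁻ u, ∫⁻ v, ∫⁻ w, ENNReal.ofReal
      ((f ((a • u + c • w) + b • v) - f ((a • u + c • w) - b • v)) ^ 2)
      ∂(stdGaussian E) ∂(stdGaussian E) ∂(stdGaussian E) = gaussianIncrement f b := by
  have hpos : 0 < √(1 - b ^ 2) := Real.sqrt_pos.2 (by linarith)
  have hsq : √(1 - b ^ 2) ^ 2 = 1 - b ^ 2 := Real.sq_sqrt (by linarith)
  rw [gaussianIncrement, lintegral_lintegral_swap]
  conv_rhs => rw [lintegral_lintegral_swap (by unfold Function.uncurry; fun_prop)]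
  · refine lintegral_congr fun v ↦ ?_
    conv_rhs => rw [← lintegral_linearCombination_stdGaussian (a := a / √(1 - b ^ 2)) (b := c / √(1 - b ^ 2))
      (by rw [div_pow, div_pow, hsq, ← add_div, hc, div_self (by linarith)])
      (H := fun x ↦ ENNReal.ofReal
        ((f (√(1 - b ^ 2) • x + b • v) - f (√(1 - b ^ 2) • x - b • v)) ^ 2)) (by fun_prop)]
    simp only [smul_add, smul_smul, mul_div_cancel₀ _ hpos.ne']
  · refine Measurable.aemeasurable ?_
    unfold Function.uncurry
    refine Measurable.lintegral_prod_right ?_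
    unfold Function.uncurry
    fun_prop

/-- Here c • v + d • w is again standard Gaussian. This computes the diagonals of the quadrilateral.
-/
lemma gaussianIncrement_sqrt_two_mul {f : E → ℝ} (hf : Measurable f) {a b c : ℝ}
    (ha : a = √(1 - 2 * b ^ 2)) (hc : c ^ 2 = 1 / 2) {d : ℝ}
    (hd : d ^ 2 = 1 / 2) :
    ∫⁻ u, ∫⁻ v, ∫⁻ w, ENNReal.ofReal
      ((f (a • u + (√2 * b) • (c • v + d • w)) - f (a • u - (√2 * b) • (c • v + d • w))) ^ 2)
      ∂(stdGaussian E) ∂(stdGaussian E) ∂(stdGaussian E) = gaussianIncrement f (√2 * b) := by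
  have h2 : (√2 * b) ^ 2 = 2 * b ^ 2 := by rw [mul_pow, Real.sq_sqrt (by norm_num)]
  rw [gaussianIncrement, h2, ← ha]
  refine lintegral_congr fun u ↦ ?_
  rw [← lintegral_linearCombination_stdGaussian (a := c) (b := d) (by rw [hc, hd]; norm_num)
    (H := fun x ↦ ENNReal.ofReal ((f (a • u + (√2 * b) • x) - f (a • u - (√2 * b) • x)) ^ 2))]
  fun_prop

/-- For the values of f at the four points a • u ± b • v ± b • w, the squared diagonals sum to at
most the squared sides. In mean, each of the two diagonals contributes the increment at √2 b and
each of the four sides the increment at b. -/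
lemma gaussianIncrement_sqrt_two_mul_le {f : E → ℝ} (hf : Measurable f) {b : ℝ}
    (hb : 2 * b ^ 2 ≤ 1) : gaussianIncrement f (√2 * b) ≤ 2 * gaussianIncrement f b := by
  have hb1 : b ^ 2 < 1 := by linarith
  set a := √(1 - 2 * b ^ 2) with ha
  have ha2 : a ^ 2 = 1 - 2 * b ^ 2 := Real.sq_sqrt (by linarith)
  have hc : (1 / √2) ^ 2 = 1 / 2 := by rw [div_pow, Real.sq_sqrt (by norm_num), one_pow]
  have hc' : (-(1 / √2)) ^ 2 = 1 / 2 := by rw [neg_sq, hc]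
  have I1 := gaussianIncrement_sqrt_two_mul hf ha hc hc
  have I2 := gaussianIncrement_sqrt_two_mul hf ha hc' hc
  have J1 := lintegral_gaussianIncrement hf (a := a) (b := b) (c := b) (by linarith) hb1
  have J2 := lintegral_gaussianIncrement hf (a := a) (b := b) (c := -b) (by rw [neg_sq]; linarith)
    hb1
  have swap : ∀ c : ℝ, ∫⁻ u, ∫⁻ v, ∫⁻ w, ENNReal.ofReal
      ((f ((a • u + c • v) + b • w) - f ((a • u + c • v) - b • w)) ^ 2)
      ∂(stdGaussian E) ∂(stdGaussian E) ∂(stdGaussian E) = ∫⁻ u, ∫⁻ v, ∫⁻ w, ENNReal.ofReal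
      ((f ((a • u + c • w) + b • v) - f ((a • u + c • w) - b • v)) ^ 2)
      ∂(stdGaussian E) ∂(stdGaussian E) ∂(stdGaussian E) := by
    intro c
    refine lintegral_congr fun u ↦ ?_
    rw [lintegral_lintegral_swap]
    refine Measurable.aemeasurable ?_
    unfold Function.uncurry
    fun_prop
  have K1 := (swap b).trans J1
  have K2 := (swap (-b)).trans J2
  have key : gaussianIncrement f (√2 * b) + gaussianIncrement f (√2 * b) ≤
      (gaussianIncrement f b + gaussianIncrement f b) +
        (gaussianIncrement f b + gaussianIncrement f b) := by
    -- `I1`, `I2` are the diagonals; `J1`, `J2` the sides along v, and `K1`, `K2` those along w.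
    conv_lhs => rw [← I2]; enter [1]; rw [I2, ← I1]
    nth_rewrite 1 [← J1]
    nth_rewrite 1 [← J2]
    nth_rewrite 1 [← K1]
    nth_rewrite 1 [← K2]
    have m : ∀ {F : E → E → E → ℝ≥0∞}, Measurable (fun z : E × E × E ↦ F z.1 z.2.1 z.2.2) →
        ∀ {G : E → E → E → ℝ≥0∞},
        (∫⁻ u, ∫⁻ v, ∫⁻ w, F u v w ∂(stdGaussian E) ∂(stdGaussian E) ∂(stdGaussian E)) +
        (∫⁻ u, ∫⁻ v, ∫⁻ w, G u v w ∂(stdGaussian E) ∂(stdGaussian E) ∂(stdGaussian E)) =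
        ∫⁻ u, ∫⁻ v, ∫⁻ w, F u v w + G u v w
          ∂(stdGaussian E) ∂(stdGaussian E) ∂(stdGaussian E) := by
      intro F hF G
      rw [← lintegral_add_left]
      · refine lintegral_congr fun u ↦ ?_
        rw [← lintegral_add_left]
        · refine lintegral_congr fun v ↦ ?_
          rw [← lintegral_add_left]
          exact hF.comp (f := fun w ↦ (u, v, w)) (by fun_prop)
        · refine Measurable.lintegral_prod_right ?_
          exact hF.comp (f := fun z : E × E ↦ (u, z.1, z.2)) (by fun_prop)
      · refine Measurable.lintegral_prod_right ?_
        refine Measurable.lintegral_prod_right ?_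
        exact hF.comp (f := fun z : (E × E) × E ↦ (z.1.1, z.1.2, z.2)) (by fun_prop)
    rw [m (by fun_prop), m (by fun_prop), m (by fun_prop), m (by fun_prop)]
    refine lintegral_mono fun u ↦ lintegral_mono fun v ↦ lintegral_mono fun w ↦ ?_
    simp only [smul_add, smul_smul]
    rw [← ENNReal.ofReal_add (by positivity) (by positivity),
      ← ENNReal.ofReal_add (by positivity) (by positivity),
      ← ENNReal.ofReal_add (by positivity) (by positivity),
      ← ENNReal.ofReal_add (by positivity) (by positivity)]
    refine ENNReal.ofReal_le_ofReal ?_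
    have r1 : √2 * b * (1 / √2) = b := by field_simp
    have r2 : √2 * b * (-(1 / √2)) = -b := by field_simp
    rw [r1, r2]
    have p1 : a • u + b • w + b • v = a • u + b • v + b • w := by abel
    have p2 : a • u + (b • v + b • w) = a • u + b • v + b • w := by abel
    have p3 : a • u - (b • v + b • w) = a • u - b • v - b • w := by abel
    have p4 : a • u + (-b • v + b • w) = a • u - b • v + b • w := by rw [neg_smul]; abel
    have p5 : a • u - (-b • v + b • w) = a • u + b • v - b • w := by rw [neg_smul]; abel
    have p6 : a • u + b • w - b • v = a • u - b • v + b • w := by abel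
    have p7 : a • u + -b • w + b • v = a • u + b • v - b • w := by rw [neg_smul]; abel
    have p8 : a • u + -b • w - b • v = a • u - b • v - b • w := by rw [neg_smul]; abel
    have p9 : a • u + -b • v + b • w = a • u - b • v + b • w := by rw [neg_smul]; abel
    have p10 : a • u + -b • v - b • w = a • u - b • v - b • w := by rw [neg_smul]; abel
    rw [p1, p2, p3, p4, p5, p6, p7, p8, p9, p10]
    -- The square is exactly sides minus diagonals.
    nlinarith [sq_nonneg (f (a • u + b • v + b • w) + f (a • u - b • v - b • w)
      - f (a • u - b • v + b • w) - f (a • u + b • v - b • w))]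
  rw [← two_mul, ← two_mul] at key
  rw [two_mul (gaussianIncrement f b)]
  exact (ENNReal.mul_le_mul_iff_right two_ne_zero ENNReal.ofNat_ne_top).1 key

lemma gaussianIncrement_sqrt_inv_two {f : E → ℝ} (hf : Measurable f) :
    gaussianIncrement f (√(1 / 2)) =
      ∫⁻ u, ∫⁻ v, ENNReal.ofReal ((f u - f v) ^ 2) ∂(stdGaussian E) ∂(stdGaussian E) := by
  have h : √(1 / 2 : ℝ) ^ 2 = 1 / 2 := Real.sq_sqrt (by norm_num)
  rw [← lintegral_rotation_stdGaussian (a := √(1 / 2)) (b := -√(1 / 2))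
    (by rw [neg_sq, h]; norm_num) (H := fun z : E × E ↦ ENNReal.ofReal ((f z.1 - f z.2) ^ 2))
    (by fun_prop), gaussianIncrement, h]
  refine lintegral_congr fun u ↦ lintegral_congr fun v ↦ ?_
  rw [neg_neg, neg_smul, ← sub_eq_add_neg, show (1 : ℝ) - 1 / 2 = 1 / 2 by norm_num, sub_sq_comm]

lemma gaussianIncrement_le_two_pow {f : E → ℝ} (hf : Measurable f) (k : ℕ) :
    gaussianIncrement f (√(1 / 2)) ≤ 2 ^ k * gaussianIncrement f (√((1 / 2) ^ (k + 1))) := by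
  induction k with
  | zero => simp
  | succ k ih =>
    refine ih.trans ?_
    rw [pow_succ (2 : ℝ≥0∞), mul_assoc]
    gcongr
    have e : √((1 / 2 : ℝ) ^ (k + 1)) = √2 * √((1 / 2) ^ (k + 1 + 1)) := by
      rw [← Real.sqrt_mul (by norm_num)]
      congr 1
      ring
    rw [e]
    refine gaussianIncrement_sqrt_two_mul_le hf ?_
    rw [Real.sq_sqrt (by positivity), pow_succ']
    have : (1 / 2 : ℝ) ^ (k + 1) ≤ 1 := pow_le_one₀ (by norm_num) (by norm_num)
    linarith

end GaussianPoincare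

/-! ### Almost everywhere differentiability and the small-scale limit -/

section AbsolutelyContinuous

lemma absolutelyContinuous_pi_fin {n : ℕ} {μ ν : Fin n → Measure ℝ}
    [∀ i, SigmaFinite (μ i)] [∀ i, SigmaFinite (ν i)] (h : ∀ i, μ i ≪ ν i) :
    Measure.pi μ ≪ Measure.pi ν := by
  induction n with
  | zero => rw [Measure.pi_of_empty, Measure.pi_of_empty]
  | succ n ih =>
    have h1 := (measurePreserving_piFinSuccAbove μ 0).symm
    have h2 := (measurePreserving_piFinSuccAbove ν 0).symm
    rw [← h1.map_eq, ← h2.map_eq]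
    exact ((h 0).prod (ih fun i ↦ h _)).map (MeasurableEquiv.measurable _)

/-- Transfers Rademacher's theorem from Lebesgue measure to the Gaussian. -/
lemma stdGaussian_absolutelyContinuous (n : ℕ) :
    stdGaussian (EuclideanSpace ℝ (Fin n)) ≪ volume := by
  rw [← map_pi_eq_stdGaussian, ← (PiLp.volume_preserving_toLp (Fin n)).map_eq]
  exact (absolutelyContinuous_pi_fin fun i ↦ gaussianReal_absolutelyContinuous 0 one_ne_zero).map
    (by fun_prop)

end AbsolutelyContinuous

section SymmetricIncrement

variable {E : Type*} [NormedAddCommGroup E] [InnerProductSpace ℝ E]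

lemma hasDerivAt_sqrt_one_sub_sq : HasDerivAt (fun b : ℝ ↦ √(1 - b ^ 2)) 0 0 := by
  have h : HasDerivAt (fun b : ℝ ↦ 1 - b ^ 2) 0 0 := by
    simpa using ((hasDerivAt_id (0 : ℝ)).pow 2).const_sub 1
  simpa using h.sqrt (by norm_num)

/-- The factor √(1 - b²) has zero derivative at b = 0, so only the displacement along v survives. -/
lemma tendsto_symmetric_increment {f : E → ℝ} {u : E} (hf : DifferentiableAt ℝ f u) (v : E) :
    Tendsto (fun b : ℝ ↦ b⁻¹ *
      (f (√(1 - b ^ 2) • u + b • v) - f (√(1 - b ^ 2) • u - b • v))) (𝓝[≠] 0)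
      (𝓝 (2 * fderiv ℝ f u v)) := by
  have key : ∀ w : E, HasDerivAt (fun b : ℝ ↦ f (√(1 - b ^ 2) • u + b • w)) (fderiv ℝ f u w) 0 := by
    intro w
    have h1 : HasDerivAt (fun b : ℝ ↦ √(1 - b ^ 2) • u + b • w) w 0 := by
      have h0 := (hasDerivAt_sqrt_one_sub_sq.smul_const u).fun_add
        ((hasDerivAt_id (0 : ℝ)).smul_const w)
      simpa using h0
    have h2 : HasFDerivAt f (fderiv ℝ f u) (√(1 - (0 : ℝ) ^ 2) • u + (0 : ℝ) • w) := by
      simpa using hf.hasFDerivAt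
    exact h2.comp_hasDerivAt (0 : ℝ) h1
  have h := ((key v).sub (key (-v))).tendsto_slope_zero
  refine (h.congr fun b ↦ ?_).trans (le_of_eq ?_)
  · simp [sub_eq_add_neg]
  · simp [two_mul]

end SymmetricIncrement

/-! ### The Gaussian Poincaré inequality -/

section GaussianPoincare

variable {E : Type*} [NormedAddCommGroup E] [InnerProductSpace ℝ E] [FiniteDimensional ℝ E]
  [MeasurableSpace E] [BorelSpace E]

lemma integral_sq_strongDual_stdGaussian (ℓ : StrongDual ℝ E) :
    ∫ x, (ℓ x) ^ 2 ∂(stdGaussian E) = ‖ℓ‖ ^ 2 := by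
  rw [← variance_dual_stdGaussian, variance_eq_integral ℓ.continuous.aemeasurable]
  simp

lemma integrable_norm_sq_stdGaussian : Integrable (fun x : E ↦ ‖x‖ ^ 2) (stdGaussian E) :=
  (IsGaussian.memLp_two_id (μ := stdGaussian E)).integrable_norm_pow (by norm_num)

lemma LipschitzWith.memLp_two_stdGaussian {f : E → ℝ} {L : ℝ≥0} (hf : LipschitzWith L f) :
    MemLp f 2 (stdGaussian E) := by
  have h : MemLp (fun x : E ↦ |f 0| + L * ‖x‖) 2 (stdGaussian E) :=
    (memLp_const (|f 0|)).add (MemLp.const_mul (f := fun x : E ↦ ‖x‖)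
      (IsGaussian.memLp_two_id (μ := stdGaussian E)).norm (L : ℝ))
  refine h.mono hf.continuous.aestronglyMeasurable (ae_of_all _ fun x ↦ ?_)
  have h1 := hf.dist_le_mul x 0
  rw [Real.dist_eq, dist_zero_right] at h1
  rw [Real.norm_eq_abs, Real.norm_of_nonneg (by positivity)]
  calc |f x| = |f 0 + (f x - f 0)| := by ring_nf
    _ ≤ |f 0| + |f x - f 0| := abs_add_le _ _
    _ ≤ _ := by linarith

lemma lintegral_sq_strongDual_stdGaussian (ℓ : StrongDual ℝ E) :
    ∫⁻ x, ENNReal.ofReal ((ℓ x) ^ 2) ∂(stdGaussian E) = ENNReal.ofReal (‖ℓ‖ ^ 2) := by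
  rw [← integral_sq_strongDual_stdGaussian ℓ, ofReal_integral_eq_lintegral_ofReal]
  · exact (ℓ.lipschitz.memLp_two_stdGaussian).integrable_sq
  · exact ae_of_all _ fun x ↦ sq_nonneg _

/-- Iterating the doubling bound gives 2^k times the increment at scale b_k = 2^(-(k+1)/2), and 2^k
= b_k⁻²/2. As k → ∞, Rademacher and dominated convergence yield the mean of 2(f'(u)v)²; integrating
in v leaves 2‖f'(u)‖² ≤ 2L². -/
lemma lintegral_sub_sq_stdGaussian_le {n : ℕ} {f : EuclideanSpace ℝ (Fin n) → ℝ} {L : ℝ≥0}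
    (hf : LipschitzWith L f) :
    ∫⁻ u, ∫⁻ v, ENNReal.ofReal ((f u - f v) ^ 2)
      ∂(stdGaussian (EuclideanSpace ℝ (Fin n))) ∂(stdGaussian (EuclideanSpace ℝ (Fin n))) ≤
      ENNReal.ofReal (2 * L ^ 2) := by
  set μ := stdGaussian (EuclideanSpace ℝ (Fin n)) with hμ
  have hfm := hf.continuous.measurable
  rw [← gaussianIncrement_sqrt_inv_two hfm]
  set b : ℕ → ℝ := fun k ↦ √((1 / 2) ^ (k + 1)) with hb
  have hb0 : ∀ k, 0 < b k := fun k ↦ Real.sqrt_pos.2 (by positivity)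
  have hb2 : ∀ k, (2 : ℝ) ^ k = 1 / 2 * (b k)⁻¹ ^ 2 := by
    intro k
    rw [inv_pow, hb, Real.sq_sqrt (by positivity), ← inv_pow, one_div, inv_inv, pow_succ]
    ring
  have hblim : Tendsto b atTop (𝓝[≠] 0) := by
    refine tendsto_nhdsWithin_iff.2 ⟨?_, Eventually.of_forall fun k ↦ (hb0 k).ne'⟩
    have h1 : Tendsto (fun k : ℕ ↦ (1 / 2 : ℝ) ^ (k + 1)) atTop (𝓝 0) :=
      (tendsto_pow_atTop_nhds_zero_of_lt_one (by norm_num) (by norm_num)).comp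
        (tendsto_add_atTop_nat 1)
    rw [← Real.sqrt_zero]
    exact (Real.continuous_sqrt.tendsto 0).comp h1
  let F : ℕ → EuclideanSpace ℝ (Fin n) × EuclideanSpace ℝ (Fin n) → ℝ := fun k z ↦
    1 / 2 * ((b k)⁻¹ * (f (√(1 - b k ^ 2) • z.1 + b k • z.2)
      - f (√(1 - b k ^ 2) • z.1 - b k • z.2))) ^ 2
  have hFm : ∀ k, Measurable (F k) := fun k ↦ by fun_prop
  have hle : ∀ k, gaussianIncrement f (√(1 / 2)) ≤ ∫⁻ z, ENNReal.ofReal (F k z) ∂(μ.prod μ) := by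
    intro k
    refine (gaussianIncrement_le_two_pow hfm k).trans (le_of_eq ?_)
    rw [lintegral_prod _ (hFm k).ennreal_ofReal.aemeasurable, gaussianIncrement,
      ← lintegral_const_mul _ (by fun_prop)]
    refine lintegral_congr fun u ↦ ?_
    rw [← lintegral_const_mul _ (by fun_prop)]
    refine lintegral_congr fun v ↦ ?_
    have : (2 : ℝ≥0∞) ^ k = ENNReal.ofReal (2 ^ k) := by
      rw [ENNReal.ofReal_pow (by norm_num), ENNReal.ofReal_ofNat]
    rw [this, ← ENNReal.ofReal_mul (by positivity), hb2]
    congr 1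
    simp only [F]
    ring
  have hbound : ∀ k z, F k z ≤ 2 * L ^ 2 * ‖z.2‖ ^ 2 := by
    intro k z
    have h1 := hf.dist_le_mul (√(1 - b k ^ 2) • z.1 + b k • z.2) (√(1 - b k ^ 2) • z.1 - b k • z.2)
    have h2 : √(1 - b k ^ 2) • z.1 + b k • z.2 - (√(1 - b k ^ 2) • z.1 - b k • z.2) =
        (2 * b k) • z.2 := by
      rw [mul_smul, two_smul]
      abel
    rw [Real.dist_eq, dist_eq_norm, h2, norm_smul, Real.norm_of_nonneg (by linarith [hb0 k])] at h1
    have h3 := mul_le_mul_of_nonneg_left h1 (inv_nonneg.2 (hb0 k).le)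
    have h4 : (b k)⁻¹ * (L * (2 * b k * ‖z.2‖)) = 2 * L * ‖z.2‖ := by
      have := (hb0 k).ne'
      field_simp
    rw [h4, ← abs_of_pos (inv_pos.2 (hb0 k)), ← abs_mul] at h3
    have h5 := pow_le_pow_left₀ (abs_nonneg _) h3 2
    rw [sq_abs] at h5
    simp only [F]
    nlinarith
  have hnorm : Integrable (fun z : EuclideanSpace ℝ (Fin n) × EuclideanSpace ℝ (Fin n) ↦
      2 * (L : ℝ) ^ 2 * ‖z.2‖ ^ 2) (μ.prod μ) :=
    (integrable_norm_sq_stdGaussian.comp_snd μ).const_mul _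
  have hdiff : ∀ᵐ z ∂(μ.prod μ), DifferentiableAt ℝ f z.1 := by
    have h1 : ∀ᵐ u ∂μ, DifferentiableAt ℝ f u :=
      (stdGaussian_absolutelyContinuous n).ae_le hf.ae_differentiableAt
    exact Measure.quasiMeasurePreserving_fst.ae h1
  have hlim := tendsto_lintegral_of_dominated_convergence (μ := μ.prod μ)
    (F := fun k z ↦ ENNReal.ofReal (F k z))
    (f := fun z ↦ ENNReal.ofReal (1 / 2 * (2 * fderiv ℝ f z.1 z.2) ^ 2))
    (fun z ↦ ENNReal.ofReal (2 * L ^ 2 * ‖z.2‖ ^ 2))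
    (fun k ↦ (hFm k).ennreal_ofReal)
    (fun k ↦ ae_of_all _ fun z ↦ ENNReal.ofReal_le_ofReal (hbound k z))
    hnorm.lintegral_lt_top.ne
    (by
      filter_upwards [hdiff] with z hz
      refine ENNReal.tendsto_ofReal ?_
      exact (((tendsto_symmetric_increment hz z.2).comp hblim).pow 2).const_mul _)
  refine (ge_of_tendsto' hlim hle).trans ?_
  have hm : Measurable fun z : EuclideanSpace ℝ (Fin n) × EuclideanSpace ℝ (Fin n) ↦
      fderiv ℝ f z.1 z.2 := by
    have h1 : Measurable fun z : EuclideanSpace ℝ (Fin n) × EuclideanSpace ℝ (Fin n) ↦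
      fderiv ℝ f z.1 := (measurable_fderiv ℝ f).comp measurable_fst
    exact isBoundedBilinearMap_apply.continuous.measurable.comp (h1.prodMk measurable_snd)
  rw [lintegral_prod _ (by fun_prop)]
  calc ∫⁻ u, ∫⁻ v, ENNReal.ofReal (1 / 2 * (2 * fderiv ℝ f u v) ^ 2) ∂μ ∂μ
      ≤ ∫⁻ u, ENNReal.ofReal (2 * L ^ 2) ∂μ := by
        refine lintegral_mono fun u ↦ ?_
        have h1 : ∀ v, ENNReal.ofReal (1 / 2 * (2 * fderiv ℝ f u v) ^ 2) =
            ENNReal.ofReal 2 * ENNReal.ofReal ((fderiv ℝ f u v) ^ 2) := by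
          intro v
          rw [← ENNReal.ofReal_mul (by norm_num)]
          congr 1
          ring
        simp only [h1]
        rw [lintegral_const_mul _ (by fun_prop), lintegral_sq_strongDual_stdGaussian,
          ← ENNReal.ofReal_mul (by norm_num)]
        gcongr
        exact norm_fderiv_le_of_lipschitz ℝ hf
    _ = ENNReal.ofReal (2 * L ^ 2) := by simp

/-- **Gaussian Poincaré inequality** for Lipschitz functions. -/
theorem integral_sub_integral_sq_stdGaussian_le {n : ℕ} {f : EuclideanSpace ℝ (Fin n) → ℝ}
    {L : ℝ≥0} (hf : LipschitzWith L f) :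
    ∫ x, (f x - ∫ y, f y ∂(stdGaussian (EuclideanSpace ℝ (Fin n)))) ^ 2
      ∂(stdGaussian (EuclideanSpace ℝ (Fin n))) ≤ L ^ 2 := by
  set μ := stdGaussian (EuclideanSpace ℝ (Fin n)) with hμ
  have hL2 : MemLp f 2 μ := hf.memLp_two_stdGaussian
  have hfm := hf.continuous.measurable
  have hint : Integrable f μ := hL2.integrable (by norm_num)
  have hsq : Integrable (fun x ↦ f x ^ 2) μ := hL2.integrable_sq
  set m := ∫ y, f y ∂μ with hm
  have hquadint : ∀ a : ℝ, Integrable (fun x ↦ f x ^ 2 - a * f x) μ := fun a ↦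
    hsq.sub (hint.const_mul a)
  have hquad : ∀ a c : ℝ, ∫ x, (f x ^ 2 - a * f x + c) ∂μ = ∫ x, f x ^ 2 ∂μ - a * m + c := by
    intro a c
    rw [integral_add (hquadint a) (integrable_const _), integral_sub hsq (hint.const_mul a),
      integral_const_mul, ← hm]
    simp
  have hvar : ∫ x, (f x - m) ^ 2 ∂μ = ∫ x, f x ^ 2 ∂μ - m ^ 2 := by
    have h1 : ∀ x, (f x - m) ^ 2 = f x ^ 2 - 2 * m * f x + m ^ 2 := fun x ↦ by ring
    simp only [h1]
    rw [hquad]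
    ring
  have hinner : ∀ u, ∫ v, (f u - f v) ^ 2 ∂μ = f u ^ 2 - 2 * m * f u + ∫ x, f x ^ 2 ∂μ := by
    intro u
    have h1 : ∀ v, (f u - f v) ^ 2 = f v ^ 2 - 2 * f u * f v + f u ^ 2 := fun v ↦ by ring
    simp only [h1]
    rw [hquad]
    ring
  have hinnerint : ∀ u, Integrable (fun v ↦ (f u - f v) ^ 2) μ := fun u ↦
    ((memLp_const (f u)).sub hL2).integrable_sq
  -- Two independent copies differ in mean square by twice the variance.
  have hlhs : ∫⁻ u, ∫⁻ v, ENNReal.ofReal ((f u - f v) ^ 2) ∂μ ∂μ =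
      ENNReal.ofReal (2 * ∫ x, (f x - m) ^ 2 ∂μ) := by
    have h1 : ∀ u, ∫⁻ v, ENNReal.ofReal ((f u - f v) ^ 2) ∂μ =
        ENNReal.ofReal (f u ^ 2 - 2 * m * f u + ∫ x, f x ^ 2 ∂μ) := by
      intro u
      rw [← hinner, ofReal_integral_eq_lintegral_ofReal (hinnerint u)
        (ae_of_all _ fun v ↦ sq_nonneg _)]
    simp only [h1]
    rw [← ofReal_integral_eq_lintegral_ofReal]
    · congr 1
      rw [hquad, hvar]
      ring
    · exact (hquadint _).add (integrable_const _)
    · refine ae_of_all _ fun u ↦ ?_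
      simp only [Pi.zero_apply]
      rw [← hinner]
      exact integral_nonneg fun v ↦ sq_nonneg _
  have h := lintegral_sub_sq_stdGaussian_le hf
  rw [← hμ, hlhs, ENNReal.ofReal_le_ofReal_iff (by positivity)] at h
  linarith

end GaussianPoincare

/-! ### Convex projections and support functions -/

section ConvexProjection

variable {E : Type*} [NormedAddCommGroup E] [InnerProductSpace ℝ E]

/-- `P` sends every point to its nearest point in the convex set `K`. -/
structure IsConvexProj (K : Set E) (P : E → E) : Prop where
  mem : ∀ g, P g ∈ K
  inner_le_zero : ∀ g, ∀ w ∈ K, ⟪g - P g, w - P g⟫ ≤ 0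

lemma exists_isConvexProj [CompleteSpace E] {K : Set E} (hne : K.Nonempty) (hc : IsClosed K)
    (hconv : Convex ℝ K) : ∃ P : E → E, IsConvexProj K P := by
  have h : ∀ g, ∃ p ∈ K, ∀ w ∈ K, ⟪g - p, w - p⟫ ≤ 0 := by
    intro g
    obtain ⟨p, hp, hmin⟩ := exists_norm_eq_iInf_of_complete_convex hne hc.isComplete hconv g
    exact ⟨p, hp, (norm_eq_iInf_iff_real_inner_le_zero hconv hp).1 hmin⟩
  choose P hP using h
  exact ⟨P, fun g ↦ (hP g).1, fun g ↦ (hP g).2⟩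

/-- Firm nonexpansiveness: each projection is tested in the variational inequality of the other. It
makes both P and the residual map 1-Lipschitz. -/
lemma IsConvexProj.norm_sub_sq_le_inner {K : Set E} {P : E → E} (hP : IsConvexProj K P) (g h : E) :
    ‖P g - P h‖ ^ 2 ≤ ⟪g - h, P g - P h⟫ := by
  have h1 := hP.inner_le_zero g _ (hP.mem h)
  have h2 := hP.inner_le_zero h _ (hP.mem g)
  rw [← real_inner_self_eq_norm_sq]
  simp only [inner_sub_left, inner_sub_right] at *
  linarith

lemma IsConvexProj.norm_sub_le {K : Set E} {P : E → E} (hP : IsConvexProj K P) (g h : E) :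
    ‖P g - P h‖ ≤ ‖g - h‖ := by
  have h1 := hP.norm_sub_sq_le_inner g h
  have h2 := real_inner_le_norm (g - h) (P g - P h)
  by_contra! hlt
  nlinarith [norm_nonneg (g - h), norm_nonneg (P g - P h)]

lemma IsConvexProj.norm_residual_sub_le {K : Set E} {P : E → E} (hP : IsConvexProj K P) (g h : E) :
    ‖(g - P g) - (h - P h)‖ ≤ ‖g - h‖ := by
  have h1 := hP.norm_sub_sq_le_inner g h
  have h2 : (g - P g) - (h - P h) = (g - h) - (P g - P h) := by abel
  rw [h2]
  refine (sq_le_sq₀ (norm_nonneg _) (norm_nonneg _)).1 ?_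
  rw [norm_sub_sq_real]
  nlinarith [sq_nonneg ‖P g - P h‖]

lemma IsConvexProj.norm_residual_le {K : Set E} {P : E → E} (hP : IsConvexProj K P) (g : E) {w : E}
    (hw : w ∈ K) : ‖g - P g‖ ≤ ‖g - w‖ := by
  refine (sq_le_sq₀ (norm_nonneg _) (norm_nonneg _)).1 ?_
  have h1 := hP.inner_le_zero g w hw
  have h2 : g - w = (g - P g) - (w - P g) := by abel
  rw [h2, norm_sub_sq_real (g - P g)]
  nlinarith [sq_nonneg ‖w - P g‖]

end ConvexProjection

section SupportFunction

variable {E : Type*} [NormedAddCommGroup E] [InnerProductSpace ℝ E]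

/-- The support function `v ↦ sup {⟪v, s⟫ : s ∈ S}` of a set `S`. -/
noncomputable def supportFun (S : Set E) (v : E) : ℝ := sSup ((fun s ↦ ⟪v, s⟫) '' S)

lemma inner_le_supportFun {S : Set E} (hS : IsCompact S) (v : E) {s : E} (hs : s ∈ S) :
    ⟪v, s⟫ ≤ supportFun S v :=
  le_csSup (hS.image (by fun_prop)).bddAbove ⟨s, hs, rfl⟩

lemma exists_inner_eq_supportFun {S : Set E} (hS : IsCompact S) (hne : S.Nonempty) (v : E) :
    ∃ s ∈ S, ⟪v, s⟫ = supportFun S v :=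
  (hS.image (by fun_prop)).sSup_mem (hne.image _)

lemma supportFun_sub_le {S : Set E} (hS : IsCompact S) (hne : S.Nonempty) {R : ℝ}
    (hR : ∀ s ∈ S, ‖s‖ ≤ R) (v w : E) : supportFun S v ≤ supportFun S w + R * ‖v - w‖ := by
  obtain ⟨s, hs, hv⟩ := exists_inner_eq_supportFun hS hne v
  have h1 := inner_le_supportFun hS w hs
  have h2 := real_inner_le_norm (v - w) s
  have h3 := mul_le_mul_of_nonneg_left (hR s hs) (norm_nonneg (v - w))
  rw [inner_sub_left] at h2
  linarith

/-- The support function at the residual is a subgradient of the squared distance to the dilations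
of a compact convex set, as a function of the dilation factor. -/
lemma norm_residual_sq_le_of_isConvexProj_smul {S : Set E} (hS : IsCompact S) (hne : S.Nonempty)
    {a₀ : ℝ} {Q : E → E} (hQ : IsConvexProj (a₀ • S) Q) (g : E) {a : ℝ} (ha : 0 ≤ a)
    {s : E} (hs : s ∈ S) :
    ‖g - Q g‖ ^ 2 ≤ ‖g - a • s‖ ^ 2 + 2 * (supportFun S (g - Q g) * (a - a₀)) := by
  obtain ⟨s', hs', hv⟩ := exists_inner_eq_supportFun hS hne (g - Q g)
  -- With v = g - Q g: testing at a₀ • s' gives a₀σ ≤ ⟪v, Q g⟫, while ⟪v, a • s⟫ ≤ aσ.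
  have h1 := hQ.inner_le_zero g _ (Set.smul_mem_smul_set hs')
  have h2 := mul_le_mul_of_nonneg_left (inner_le_supportFun hS (g - Q g) hs) ha
  rw [inner_sub_right, real_inner_smul_right, hv] at h1
  have h3 : g - a • s = (g - Q g) + (Q g - a • s) := by abel
  rw [h3, norm_add_sq_real, inner_sub_right, real_inner_smul_right]
  nlinarith [sq_nonneg ‖Q g - a • s‖]

end SupportFunction

/-! ### The cone generated by S, with multiples of e -/

section ConeSum

variable {E : Type*} [NormedAddCommGroup E] [InnerProductSpace ℝ E]

/-- The sum of the cone generated by `S` and of the multiples `t • e` with `t ∈ T`. -/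
def coneSum (S : Set E) (e : E) (T : Set ℝ) : Set E :=
  {y | ∃ a : ℝ, 0 ≤ a ∧ ∃ s ∈ S, ∃ t ∈ T, y = a • s + t • e}

lemma convex_coneSum {S : Set E} (hS : Convex ℝ S) (e : E) {T : Set ℝ} (hT : Convex ℝ T) :
    Convex ℝ (coneSum S e T) := by
  rintro _ ⟨a, ha, s, hs, t, ht, rfl⟩ _ ⟨b, hb, s', hs', t', ht', rfl⟩ p q hp hq hpq
  have hT' := hT ht ht' hp hq hpq
  by_cases h : p * a + q * b = 0
  · have h1 : p * a = 0 := by nlinarith [mul_nonneg hp ha, mul_nonneg hq hb]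
    have h2 : q * b = 0 := by nlinarith [mul_nonneg hp ha, mul_nonneg hq hb]
    refine ⟨0, le_rfl, s, hs, _, hT', ?_⟩
    simp only [smul_add, smul_smul, h1, h2, add_smul, smul_eq_mul]
    simp
  · have hpos : 0 < p * a + q * b :=
      lt_of_le_of_ne (add_nonneg (mul_nonneg hp ha) (mul_nonneg hq hb)) (Ne.symm h)
    have hmem := hS hs hs' (a := p * a / (p * a + q * b)) (b := q * b / (p * a + q * b))
      (div_nonneg (mul_nonneg hp ha) hpos.le) (div_nonneg (mul_nonneg hq hb) hpos.le)
      (by rw [← add_div, div_self h])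
    refine ⟨p * a + q * b, hpos.le, _, hmem, _, hT', ?_⟩
    simp only [smul_add, smul_smul, add_smul, smul_eq_mul, mul_div_cancel₀ _ h]
    abel

/-- Pairing with e gives a * c + t, so the coefficients of points near z are bounded and the set is
locally contained in a compact image. -/
lemma isClosed_coneSum {S : Set E} (hS : IsCompact S) {e : E} (he : ‖e‖ = 1) {c : ℝ} (hc : 0 < c)
    (hSe : ∀ s ∈ S, ⟪s, e⟫ = c) {T : Set ℝ} (hT : IsClosed T) (hT0 : ∀ t ∈ T, 0 ≤ t) :
    IsClosed (coneSum S e T) := by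
  refine isClosed_of_closure_subset fun z hz ↦ ?_
  set r := ‖z‖ + 1
  have hK : IsCompact ((fun q : ℝ × E × ℝ ↦ q.1 • q.2.1 + q.2.2 • e) ''
      (Set.Icc 0 (r / c) ×ˢ S ×ˢ (T ∩ Set.Icc 0 r))) :=
    (isCompact_Icc.prod (hS.prod (isCompact_Icc.inter_left hT))).image (by fun_prop)
  have hsub : Metric.ball z 1 ∩ coneSum S e T ⊆ (fun q : ℝ × E × ℝ ↦ q.1 • q.2.1 + q.2.2 • e) ''
      (Set.Icc 0 (r / c) ×ˢ S ×ˢ (T ∩ Set.Icc 0 r)) := by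
    rintro _ ⟨hy, a, ha, s, hs, t, ht, rfl⟩
    have hn : ‖a • s + t • e‖ ≤ r := by
      have h1 := norm_sub_norm_le (a • s + t • e) z
      rw [mem_ball_iff_norm] at hy
      linarith
    have hi := real_inner_le_norm (a • s + t • e) e
    rw [he, mul_one, inner_add_left, real_inner_smul_left, real_inner_smul_left, hSe s hs,
      real_inner_self_eq_norm_sq, he] at hi
    have ht0 := hT0 t ht
    have hac := mul_nonneg ha hc.le
    exact ⟨(a, s, t), ⟨⟨ha, (le_div_iff₀ hc).2 (by linarith)⟩, hs, ht, ht0, by linarith⟩, rfl⟩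
  have hz' := Metric.isOpen_ball.inter_closure ⟨Metric.mem_ball_self one_pos, hz⟩
  obtain ⟨⟨a, s, t⟩, ⟨ha, hs, ht⟩, rfl⟩ := hK.isClosed.closure_subset (closure_mono hsub hz')
  exact ⟨a, ha.1, s, hs, t, ht.1, rfl⟩

end ConeSum

/-! ### Subgradients of a seminorm -/

section Subdifferential

variable {n : ℕ}

lemma Seminorm.continuous_euclideanSpace (f : Seminorm ℝ (EuclideanSpace ℝ (Fin n))) :
    Continuous f :=
  continuousOn_univ.1 (f.convexOn.continuousOn isOpen_univ)

lemma convex_subdifferential (h : EuclideanSpace ℝ (Fin n) → ℝ) (z : EuclideanSpace ℝ (Fin n)) :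
    Convex ℝ (subdifferential h z) := by
  intro u hu v hv a b ha hb hab t
  have h1 := mul_le_mul_of_nonneg_left (hu t) ha
  have h2 := mul_le_mul_of_nonneg_left (hv t) hb
  rw [inner_add_left, real_inner_smul_left, real_inner_smul_left]
  have h3 : b = 1 - a := by linarith
  subst h3
  linarith

lemma inner_eq_of_mem_subdifferential {f : Seminorm ℝ (EuclideanSpace ℝ (Fin n))}
    {x s : EuclideanSpace ℝ (Fin n)} (hs : s ∈ subdifferential f x) : ⟪s, x⟫ = f x := by
  have h1 := hs x
  have h2 := hs (-x)
  have h3 : f (x + x) = 2 * f x := by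
    rw [← two_smul ℝ x, map_smul_eq_mul, Real.norm_of_nonneg (by norm_num)]
  rw [add_neg_cancel, map_zero, inner_neg_right] at h2
  linarith

/-- Separate the open sublevel set from the ray x + t • d, t ≥ 0. As 0 lies in the sublevel set, the
separation level α is positive; homogeneity then makes f x / α times the functional a subgradient.
-/
lemma exists_mem_subdifferential_inner_nonneg {f : Seminorm ℝ (EuclideanSpace ℝ (Fin n))}
    {x d : EuclideanSpace ℝ (Fin n)} (hx : 0 < f x) (hd : ∀ t : ℝ, 0 < t → f x < f (x + t • d)) :
    ∃ s ∈ subdifferential f x, 0 ≤ ⟪s, d⟫ := by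
  have hcont := f.continuous_euclideanSpace
  have hconvA : Convex ℝ {z | f z < f x} := by
    simpa using f.convexOn.convex_lt (f x)
  have hopen : IsOpen {z | f z < f x} := isOpen_lt hcont continuous_const
  have hconvB : Convex ℝ ((fun t : ℝ ↦ x + t • d) '' Set.Ici 0) := by
    rintro _ ⟨t, ht, rfl⟩ _ ⟨t', ht', rfl⟩ a b ha hb hab
    refine ⟨a * t + b * t', add_nonneg (mul_nonneg ha ht) (mul_nonneg hb ht'), ?_⟩
    simp only [smul_add, add_smul, smul_smul]
    have : x = a • x + b • x := by rw [← add_smul, hab, one_smul]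
    nth_rewrite 1 [this]
    abel
  have hdisj : Disjoint {z | f z < f x} ((fun t : ℝ ↦ x + t • d) '' Set.Ici 0) := by
    rw [Set.disjoint_right]
    rintro _ ⟨t, ht, rfl⟩ hlt
    rcases (Set.mem_Ici.1 ht).eq_or_lt with h0 | h0
    · subst h0
      simp at hlt
    · exact lt_asymm hlt (hd t h0)
  obtain ⟨ℓ, α, hA, hB⟩ := geometric_hahn_banach_open hconvA hopen hconvB hdisj
  have hα : 0 < α := by simpa using hA 0 (by simpa using hx)
  have hxα : α ≤ ℓ x := by simpa using hB x ⟨0, by simp, by simp⟩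
  have hle : ∀ z, f z ≤ f x → ℓ z ≤ α := by
    intro z hz
    have h1 : ∀ r : ℝ, 0 < r → r < 1 → r * ℓ z ≤ α := by
      intro r hr hr1
      have h2 := hA (r • z) (by
        change f (r • z) < f x
        rw [map_smul_eq_mul, Real.norm_of_nonneg hr.le]
        nlinarith [apply_nonneg f z])
      rw [map_smul, smul_eq_mul] at h2
      exact h2.le
    by_contra! hlt
    have hz0 : 0 < ℓ z := hα.trans hlt
    obtain ⟨r, hr1, hr2⟩ := exists_between ((div_lt_one hz0).2 hlt)
    have h3 := h1 r ((div_pos hα hz0).trans hr1) hr2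
    rw [div_lt_iff₀ hz0] at hr1
    linarith
  have hxα' : ℓ x = α := le_antisymm (hle x le_rfl) hxα
  have hdom : ∀ z, f x / α * ℓ z ≤ f z := by
    intro z
    rcases (apply_nonneg f z).eq_or_lt with h0 | h0
    · by_contra! hlt
      rw [← h0] at hlt
      have hz : 0 < ℓ z := by
        by_contra! hneg
        nlinarith [div_pos hx hα]
      have h4 := hle ((2 * α / ℓ z) • z) (by rw [map_smul_eq_mul, ← h0, mul_zero]; exact hx.le)
      rw [map_smul, smul_eq_mul, div_mul_cancel₀ _ hz.ne'] at h4
      linarith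
    · have h4 := hle ((f x / f z) • z) (by
        rw [map_smul_eq_mul, Real.norm_of_nonneg (div_pos hx h0).le, div_mul_cancel₀ _ h0.ne'])
      rw [map_smul, smul_eq_mul, div_mul_eq_mul_div, div_le_iff₀ h0] at h4
      rw [div_mul_eq_mul_div, div_le_iff₀ hα]
      linarith
  refine ⟨(f x / α) • (InnerProductSpace.toDual ℝ _).symm ℓ, fun t ↦ ?_, ?_⟩
  · rw [real_inner_smul_left, InnerProductSpace.toDual_symm_apply]
    have h5 := hdom (x + t)
    rw [map_add, hxα', mul_add, div_mul_cancel₀ _ hα.ne'] at h5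
    exact h5
  · rw [real_inner_smul_left, InnerProductSpace.toDual_symm_apply]
    have h6 := hB (x + (1 : ℝ) • d) ⟨1, by simp, rfl⟩
    rw [one_smul, map_add, hxα'] at h6
    exact mul_nonneg (div_pos hx hα).le (by linarith)

end Subdifferential

/-! ### The restricted cone and its polar -/

section PriorRestrictedCone

variable {n : ℕ}

lemma mem_l2PriorRestrictedCone {f₀ : EuclideanSpace ℝ (Fin n) → ℝ}
    {xs d : EuclideanSpace ℝ (Fin n)} : d ∈ l2PriorRestrictedCone f₀ xs ↔
      ∃ t : ℝ, 0 < t ∧ f₀ (xs + t • d) ≤ f₀ xs ∧ ‖xs + t • d‖ ≤ ‖xs‖ := by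
  simp [l2PriorRestrictedCone, priorRestrictedCone, Fin.forall_fin_two]

lemma zero_mem_l2PriorRestrictedCone (f₀ : EuclideanSpace ℝ (Fin n) → ℝ)
    (xs : EuclideanSpace ℝ (Fin n)) : 0 ∈ l2PriorRestrictedCone f₀ xs :=
  mem_l2PriorRestrictedCone.2 ⟨1, one_pos, by simp, by simp⟩

lemma inner_nonpos_of_mem_l2PriorRestrictedCone {f₀ : EuclideanSpace ℝ (Fin n) → ℝ}
    {xs d s : EuclideanSpace ℝ (Fin n)} (hd : d ∈ l2PriorRestrictedCone f₀ xs)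
    (hs : s ∈ subdifferential f₀ xs) : ⟪s, d⟫ ≤ 0 := by
  obtain ⟨t, ht, h1, -⟩ := mem_l2PriorRestrictedCone.1 hd
  have h2 := hs (t • d)
  rw [real_inner_smul_right] at h2
  by_contra! hlt
  nlinarith [mul_pos ht hlt]

lemma inner_self_nonpos_of_mem_l2PriorRestrictedCone {f₀ : EuclideanSpace ℝ (Fin n) → ℝ}
    {xs d : EuclideanSpace ℝ (Fin n)} (hd : d ∈ l2PriorRestrictedCone f₀ xs) : ⟪xs, d⟫ ≤ 0 := by
  obtain ⟨t, ht, -, h1⟩ := mem_l2PriorRestrictedCone.1 hd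
  have h2 := pow_le_pow_left₀ (norm_nonneg _) h1 2
  rw [norm_add_sq_real, real_inner_smul_right] at h2
  by_contra! hlt
  nlinarith [mul_pos ht hlt, sq_nonneg ‖t • d‖]

lemma mem_l2PriorRestrictedCone_of_inner_neg {f₀ : Seminorm ℝ (EuclideanSpace ℝ (Fin n))}
    {xs d : EuclideanSpace ℝ (Fin n)} (hx : 0 < f₀ xs) (hd : ∀ s ∈ subdifferential f₀ xs, ⟪s, d⟫ < 0)
    (hxd : ⟪xs, d⟫ < 0) : d ∈ l2PriorRestrictedCone f₀ xs := by
  obtain ⟨a, ha, hfa⟩ : ∃ a : ℝ, 0 < a ∧ f₀ (xs + a • d) ≤ f₀ xs := by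
    by_contra! hcon
    obtain ⟨s, hs, hsd⟩ := exists_mem_subdifferential_inner_nonneg hx hcon
    exact (hd s hs).not_ge hsd
  -- Steps up to b do not increase ‖xs + t • d‖; the `+ 1` keeps the denominator positive.
  set b := -(2 * ⟪xs, d⟫) / (‖d‖ ^ 2 + 1) with hb
  have hb0 : 0 < b := div_pos (by linarith) (by positivity)
  have hmin : 0 < min a b := lt_min ha hb0
  refine mem_l2PriorRestrictedCone.2 ⟨min a b, hmin, ?_, ?_⟩
  · have h1 : xs + min a b • d = (1 - min a b / a) • xs + (min a b / a) • (xs + a • d) := by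
      rw [smul_add, smul_smul, div_mul_cancel₀ _ ha.ne', sub_smul, one_smul]
      abel
    have hr0 : 0 ≤ min a b / a := (div_pos hmin ha).le
    have hr1 : min a b / a ≤ 1 := (div_le_one ha).2 (min_le_left _ _)
    have h2 := f₀.convexOn.2 (Set.mem_univ xs) (Set.mem_univ (xs + a • d))
      (sub_nonneg.2 hr1) hr0 (by ring)
    rw [← h1, smul_eq_mul, smul_eq_mul] at h2
    nlinarith
  · refine (sq_le_sq₀ (norm_nonneg _) (norm_nonneg _)).1 ?_
    rw [norm_add_sq_real, real_inner_smul_right, norm_smul, Real.norm_of_nonneg hmin.le, mul_pow]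
    have h3 : min a b * (‖d‖ ^ 2 + 1) ≤ -(2 * ⟪xs, d⟫) :=
      (le_div_iff₀ (by positivity)).1 (min_le_right a b)
    nlinarith [mul_le_mul_of_nonneg_left h3 hmin.le]

end PriorRestrictedCone

/-! ### The supremum over the cone against distances -/

section ConeSup

variable {n : ℕ}

/-- The supremum of `⟪g, t⟫` over the `t ∈ K` with `‖t‖ ≤ 1`. -/
noncomputable def coneSup (K : Set (EuclideanSpace ℝ (Fin n))) (g : EuclideanSpace ℝ (Fin n)) : ℝ :=
  sSup ((fun t ↦ inner ℝ g t) '' (K ∩ Metric.closedBall 0 1))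

lemma inner_le_coneSup (K : Set (EuclideanSpace ℝ (Fin n))) (g : EuclideanSpace ℝ (Fin n))
    {t : EuclideanSpace ℝ (Fin n)} (ht : t ∈ K) (ht1 : ‖t‖ ≤ 1) : ⟪g, t⟫ ≤ coneSup K g := by
  refine le_csSup ⟨‖g‖, ?_⟩ ⟨t, ⟨ht, by simpa using ht1⟩, rfl⟩
  rintro _ ⟨u, ⟨-, hu⟩, rfl⟩
  rw [mem_closedBall_zero_iff] at hu
  exact (real_inner_le_norm g u).trans (mul_le_of_le_one_right (norm_nonneg _) hu)

lemma coneSup_le {K : Set (EuclideanSpace ℝ (Fin n))} (h0 : 0 ∈ K) {g : EuclideanSpace ℝ (Fin n)}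
    {r : ℝ} (h : ∀ t ∈ K, ‖t‖ ≤ 1 → ⟪g, t⟫ ≤ r) : coneSup K g ≤ r := by
  refine csSup_le ⟨_, 0, ⟨h0, by simp⟩, rfl⟩ ?_
  rintro _ ⟨u, ⟨hu, hu1⟩, rfl⟩
  exact h u hu (by simpa using hu1)

lemma coneSup_nonneg {K : Set (EuclideanSpace ℝ (Fin n))} (h0 : 0 ∈ K)
    (g : EuclideanSpace ℝ (Fin n)) : 0 ≤ coneSup K g := by
  simpa using inner_le_coneSup K g h0 (by simp)

lemma lipschitzWith_coneSup {K : Set (EuclideanSpace ℝ (Fin n))} (h0 : 0 ∈ K) :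
    LipschitzWith 1 (coneSup K) := by
  refine LipschitzWith.of_le_add fun g h ↦ coneSup_le h0 fun t ht ht1 ↦ ?_
  have h1 := inner_le_coneSup K h ht ht1
  have h2 := real_inner_le_norm (g - h) t
  rw [inner_sub_left] at h2
  rw [dist_eq_norm]
  nlinarith [norm_nonneg (g - h)]

/-- The supremum over the cone is at most the distance to any subset of the polar cone. -/
lemma coneSup_le_infDist {K A : Set (EuclideanSpace ℝ (Fin n))} (h0 : 0 ∈ K) (hA : A.Nonempty)
    (hKA : ∀ t ∈ K, ∀ y ∈ A, ⟪y, t⟫ ≤ 0) (g : EuclideanSpace ℝ (Fin n)) :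
    coneSup K g ≤ Metric.infDist g A := by
  refine (Metric.le_infDist hA).2 fun y hy ↦ coneSup_le h0 fun t ht ht1 ↦ ?_
  have h1 := real_inner_le_norm (g - y) t
  rw [inner_sub_left] at h1
  rw [dist_eq_norm]
  nlinarith [norm_nonneg (g - y), hKA t ht y hy]

/-- By Moreau's decomposition the residual v is polar to the cone and ⟪g, v⟫ = ‖v‖². The restricted
cone need not be closed, so v is pushed to v - η • e, which pairs strictly negatively with S and xs;
then η → 0. -/
lemma norm_residual_le_coneSup {f₀ : Seminorm ℝ (EuclideanSpace ℝ (Fin n))}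
    {xs : EuclideanSpace ℝ (Fin n)} (hx : 0 < f₀ xs)
    {P : EuclideanSpace ℝ (Fin n) → EuclideanSpace ℝ (Fin n)}
    (hP : IsConvexProj (coneSum (subdifferential f₀ xs) (‖xs‖⁻¹ • xs) (Set.Ici 0)) P)
    (g : EuclideanSpace ℝ (Fin n)) : ‖g - P g‖ ≤ coneSup (l2PriorRestrictedCone f₀ xs) g := by
  have hxs : xs ≠ 0 := fun h ↦ by simp [h] at hx
  have hnx : 0 < ‖xs‖ := norm_pos_iff.2 hxs
  set e := ‖xs‖⁻¹ • xs with he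
  set S := subdifferential f₀ xs with hS
  have hen : ‖e‖ = 1 := by rw [he, norm_smul, norm_inv, norm_norm, inv_mul_cancel₀ hnx.ne']
  have hxe : xs = ‖xs‖ • e := by rw [he, smul_smul, mul_inv_cancel₀ hnx.ne', one_smul]
  have hnn := coneSup_nonneg (zero_mem_l2PriorRestrictedCone f₀ xs) g
  obtain ⟨a, ha, s, hs, t, ht, hp⟩ := hP.mem g
  rw [Set.mem_Ici] at ht
  set v := g - P g with hv
  have hvs : ∀ s' ∈ S, ⟪s', v⟫ ≤ 0 := by
    intro s' hs'
    have hmem : P g + s' ∈ coneSum S e (Set.Ici 0) := by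
      have h2 := (convex_coneSum (convex_subdifferential f₀ xs) e (convex_Ici (0 : ℝ)))
        (show (2 : ℝ) • P g ∈ coneSum S e (Set.Ici 0) from
          ⟨2 * a, by positivity, s, hs, 2 * t, by simpa using ht, by
            rw [hp, smul_add, smul_smul, smul_smul]⟩)
        (show (2 : ℝ) • s' ∈ coneSum S e (Set.Ici 0) from
          ⟨2, by norm_num, s', hs', 0, by simp, by simp⟩)
        (a := 1 / 2) (b := 1 / 2) (by norm_num) (by norm_num) (by norm_num)
      simpa [smul_smul] using h2
    have h1 := hP.inner_le_zero g _ hmem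
    rwa [add_sub_cancel_left, real_inner_comm] at h1
  have hve : ⟪e, v⟫ ≤ 0 := by
    have hmem : P g + e ∈ coneSum S e (Set.Ici 0) :=
      ⟨a, ha, s, hs, t + 1, by simp; linarith, by rw [hp, add_smul, one_smul, add_assoc]⟩
    have h1 := hP.inner_le_zero g _ hmem
    rwa [add_sub_cancel_left, real_inner_comm] at h1
  have hvp : ⟪v, P g⟫ = 0 := by
    have h1 := hP.inner_le_zero g 0 ⟨0, le_rfl, s, hs, 0, by simp, by simp⟩
    have h2 := hP.inner_le_zero g (P g + P g) ⟨a + a, by positivity, s, hs, t + t, by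
      simp; linarith, by rw [hp, add_smul, add_smul]; abel⟩
    rw [zero_sub, inner_neg_right] at h1
    rw [add_sub_cancel_left] at h2
    exact le_antisymm h2 (by linarith)
  have hgv : ⟪g, v⟫ = ‖v‖ ^ 2 := by
    have h1 : g = v + P g := by rw [hv]; abel
    rw [h1, inner_add_left, real_inner_self_eq_norm_sq, real_inner_comm, hvp, add_zero]
  have hse : ∀ s' ∈ S, 0 < ⟪s', e⟫ := by
    intro s' hs'
    rw [he, real_inner_smul_right, inner_eq_of_mem_subdifferential hs']
    positivity
  have key : ∀ η : ℝ, 0 < η → ‖v‖ ^ 2 - η * ⟪g, e⟫ ≤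
      coneSup (l2PriorRestrictedCone f₀ xs) g * (‖v‖ + η) := by
    intro η hη
    have hpos : 0 < ‖v‖ + η := by positivity
    have hinv : 0 < (‖v‖ + η)⁻¹ := inv_pos.2 hpos
    have hmem : (‖v‖ + η)⁻¹ • (v - η • e) ∈ l2PriorRestrictedCone f₀ xs := by
      refine mem_l2PriorRestrictedCone_of_inner_neg hx (fun s' hs' ↦ ?_) ?_
      · rw [real_inner_smul_right, inner_sub_right, real_inner_smul_right]
        exact mul_neg_of_pos_of_neg hinv (by nlinarith [hvs s' hs', mul_pos hη (hse s' hs')])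
      · rw [hxe, real_inner_smul_right, real_inner_smul_left, inner_sub_right,
          real_inner_smul_right, real_inner_self_eq_norm_sq, hen]
        exact mul_neg_of_pos_of_neg hinv (mul_neg_of_pos_of_neg hnx (by linarith))
    have hnorm : ‖(‖v‖ + η)⁻¹ • (v - η • e)‖ ≤ 1 := by
      rw [norm_smul, Real.norm_of_nonneg hinv.le, inv_mul_le_iff₀ hpos, mul_one]
      refine (norm_sub_le _ _).trans ?_
      rw [norm_smul, hen, Real.norm_of_nonneg hη.le, mul_one]
    have h1 := inner_le_coneSup _ g hmem hnorm
    rw [real_inner_smul_right, inv_mul_le_iff₀ hpos, inner_sub_right, hgv,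
      real_inner_smul_right] at h1
    linarith
  have hlim : ‖v‖ ^ 2 ≤ coneSup (l2PriorRestrictedCone f₀ xs) g * ‖v‖ := by
    have h1 : Tendsto (fun η : ℝ ↦ ‖v‖ ^ 2 - η * ⟪g, e⟫) (𝓝[>] 0) (𝓝 (‖v‖ ^ 2 - 0 * ⟪g, e⟫)) :=
      (Continuous.tendsto (by fun_prop) 0).mono_left nhdsWithin_le_nhds
    have h2 : Tendsto (fun η : ℝ ↦ coneSup (l2PriorRestrictedCone f₀ xs) g * (‖v‖ + η)) (𝓝[>] 0)
        (𝓝 (coneSup (l2PriorRestrictedCone f₀ xs) g * (‖v‖ + 0))) :=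
      (Continuous.tendsto (by fun_prop) 0).mono_left nhdsWithin_le_nhds
    have h3 := le_of_tendsto_of_tendsto h1 h2
      (eventually_nhdsWithin_of_forall fun η hη ↦ key η hη)
    simpa using h3
  rcases (norm_nonneg v).eq_or_lt with h0 | h0
  · rw [← h0]; exact hnn
  · rw [sq] at hlim
    exact le_of_mul_le_mul_right hlim h0

end ConeSup

/-! ### Half moments and covariance -/

section HalfMoment

variable {E : Type*} [NormedAddCommGroup E] [InnerProductSpace ℝ E] [FiniteDimensional ℝ E]
  [MeasurableSpace E] [BorelSpace E]

lemma LipschitzWith.integrable_sq_stdGaussian {f : E → ℝ} {L : ℝ≥0} (hf : LipschitzWith L f) :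
    Integrable (fun x ↦ f x ^ 2) (stdGaussian E) :=
  hf.memLp_two_stdGaussian.integrable_sq

lemma integrable_max_inner_sq_stdGaussian (e : E) :
    Integrable (fun g : E ↦ max ⟪e, g⟫ 0 ^ 2) (stdGaussian E) :=
  (((innerSL ℝ e).lipschitz).max_const 0).integrable_sq_stdGaussian

/-- By the symmetry g ↦ -g the two half moments agree, and they sum to the variance 1. -/
lemma integral_max_inner_sq_stdGaussian {e : E} (he : ‖e‖ = 1) :
    ∫ g, max ⟪e, g⟫ 0 ^ 2 ∂(stdGaussian E) = 1 / 2 := by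
  have hneg : ∫ g, max ⟪e, g⟫ 0 ^ 2 ∂(stdGaussian E) =
      ∫ g, max ⟪-e, g⟫ 0 ^ 2 ∂(stdGaussian E) := by
    conv_lhs => rw [← stdGaussian_map (LinearIsometryEquiv.neg ℝ (E := E))]
    rw [integral_map (by fun_prop) (by fun_prop)]
    simp
  have hsum : ∫ g, max ⟪e, g⟫ 0 ^ 2 ∂(stdGaussian E) + ∫ g, max ⟪-e, g⟫ 0 ^ 2 ∂(stdGaussian E)
      = 1 := by
    rw [← integral_add (integrable_max_inner_sq_stdGaussian e)
      (integrable_max_inner_sq_stdGaussian (-e))]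
    have h1 : ∀ g : E, max ⟪e, g⟫ 0 ^ 2 + max ⟪-e, g⟫ 0 ^ 2 = (innerSL ℝ e g) ^ 2 := by
      intro g
      rw [inner_neg_left, innerSL_apply_apply]
      rcases le_total 0 ⟪e, g⟫ with h | h
      · rw [max_eq_left h, max_eq_right (by linarith)]; ring
      · rw [max_eq_right h, max_eq_left (by linarith)]; ring
    simp only [h1]
    rw [integral_sq_strongDual_stdGaussian, innerSL_apply_norm, he, one_pow]
  linarith

end HalfMoment

section Covariance

variable {n : ℕ}

/-- Covariance inequality for Lipschitz functions of a standard Gaussian vector. -/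
lemma integral_mul_sub_integral_stdGaussian_le {f h : EuclideanSpace ℝ (Fin n) → ℝ} {K L : ℝ≥0}
    (hf : LipschitzWith K f) (hh : LipschitzWith L h) (hK : 0 < K) (hL : 0 < L) :
    ∫ x, f x * (h x - ∫ y, h y ∂(stdGaussian (EuclideanSpace ℝ (Fin n))))
      ∂(stdGaussian (EuclideanSpace ℝ (Fin n))) ≤ K * L := by
  set μ := stdGaussian (EuclideanSpace ℝ (Fin n)) with hμ
  have hf2 : MemLp f 2 μ := hf.memLp_two_stdGaussian
  have hh2 : MemLp h 2 μ := hh.memLp_two_stdGaussian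
  have hfv := integral_sub_integral_sq_stdGaussian_le hf
  have hhv := integral_sub_integral_sq_stdGaussian_le hh
  rw [← hμ] at hfv hhv
  set p := ∫ x, f x ∂μ
  set q := ∫ x, h x ∂μ with hq
  have hfc : MemLp (fun x ↦ f x - p) 2 μ := hf2.sub (memLp_const p)
  have hhc : MemLp (fun x ↦ h x - q) 2 μ := hh2.sub (memLp_const q)
  have hprod : Integrable (fun x ↦ (f x - p) * (h x - q)) μ := hfc.integrable_mul hhc
  have hhci : Integrable (fun x ↦ h x - q) μ := hhc.integrable (by norm_num)
  have hzero : ∫ x, (h x - q) ∂μ = 0 := by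
    rw [integral_sub (hh2.integrable (by norm_num)) (integrable_const _), ← hq]
    simp
  have hcenter : ∫ x, f x * (h x - q) ∂μ = ∫ x, (f x - p) * (h x - q) ∂μ := by
    have h1 : ∀ x, f x * (h x - q) = (f x - p) * (h x - q) + p * (h x - q) := fun x ↦ by ring
    simp only [h1]
    rw [integral_add hprod (hhci.const_mul p), integral_const_mul, hzero, mul_zero, add_zero]
  have hK' : (0 : ℝ) < K := hK
  have hL' : (0 : ℝ) < L := hL
  rw [hcenter]
  calc ∫ x, (f x - p) * (h x - q) ∂μ
      -- Weighted AM-GM, balanced for variances bounded by K² and L².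
      ≤ ∫ x, (L / (2 * K) * (f x - p) ^ 2 + K / (2 * L) * (h x - q) ^ 2) ∂μ := by
        refine integral_mono hprod
          ((hfc.integrable_sq.const_mul _).add (hhc.integrable_sq.const_mul _)) fun x ↦ ?_
        have h1 : L / (2 * K) * (f x - p) ^ 2 + K / (2 * L) * (h x - q) ^ 2 -
            (f x - p) * (h x - q) = (L * (f x - p) - K * (h x - q)) ^ 2 / (2 * K * L) := by
          field_simp
          ring
        have h2 : 0 ≤ (L * (f x - p) - K * (h x - q)) ^ 2 / (2 * K * L) := by positivity
        change (f x - p) * (h x - q) ≤ _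
        linarith
    _ = L / (2 * K) * ∫ x, (f x - p) ^ 2 ∂μ + K / (2 * L) * ∫ x, (h x - q) ^ 2 ∂μ := by
        rw [integral_add (hfc.integrable_sq.const_mul _) (hhc.integrable_sq.const_mul _),
          integral_const_mul, integral_const_mul]
    _ ≤ L / (2 * K) * K ^ 2 + K / (2 * L) * L ^ 2 := by gcongr
    _ = K * L := by field_simp; ring

end Covariance

/-! ### The two bounds on the objective -/

section Recipe

variable {n : ℕ} {f₀ : Seminorm ℝ (EuclideanSpace ℝ (Fin n))} {xs : EuclideanSpace ℝ (Fin n)}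

lemma statisticalDimension_eq (K : Set (EuclideanSpace ℝ (Fin n))) :
    statisticalDimension K = ∫ g, coneSup K g ^ 2 ∂(stdGaussian (EuclideanSpace ℝ (Fin n))) := rfl

lemma statisticalDimension_le_l2RecipeObjective (hne : (subdifferential f₀ xs).Nonempty)
    {τ : Fin 2 → ℝ} (hτ : ∀ i, 0 ≤ τ i) :
    statisticalDimension (l2PriorRestrictedCone f₀ xs) ≤ l2RecipeObjective f₀ xs τ := by
  have h0 := zero_mem_l2PriorRestrictedCone f₀ xs
  refine integral_mono (lipschitzWith_coneSup h0).integrable_sq_stdGaussian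
    (Metric.lipschitz_infDist_pt _).integrable_sq_stdGaussian fun g ↦ ?_
  refine pow_le_pow_left₀ (coneSup_nonneg h0 g) (coneSup_le_infDist h0 ?_ ?_ g) 2
  · exact (hne.smul_set).add (Set.singleton_nonempty _)
  · rintro t ht _ ⟨_, ⟨s, hs, rfl⟩, _, rfl, rfl⟩
    have h1 := inner_nonpos_of_mem_l2PriorRestrictedCone ht hs
    have h2 := inner_self_nonpos_of_mem_l2PriorRestrictedCone ht
    simp only [inner_add_left, real_inner_smul_left]
    have h3 := mul_nonpos_of_nonneg_of_nonpos (hτ 0) h1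
    have h4 := mul_nonpos_of_nonneg_of_nonpos (hτ 1)
      (mul_nonpos_of_nonneg_of_nonpos (inv_nonneg.2 (norm_nonneg xs)) h2)
    linarith

/-- Dropping the multiples of the unit vector `e` from the cone increases the squared distance by
at most the square of the positive part of `⟪e, g⟫`. -/
lemma norm_residual_sq_le_add_max_inner_sq {E : Type*} [NormedAddCommGroup E]
    [InnerProductSpace ℝ E] {S : Set E} {e : E} (he : ‖e‖ = 1)
    (hSe : ∀ s ∈ S, 0 ≤ ⟪s, e⟫) {P Q : E → E} (hP : IsConvexProj (coneSum S e {0}) P)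
    (hQ : IsConvexProj (coneSum S e (Set.Ici 0)) Q) (g : E) :
    ‖g - P g‖ ^ 2 ≤ ‖g - Q g‖ ^ 2 + max ⟪e, g⟫ 0 ^ 2 := by
  obtain ⟨a, ha, s, hs, t, ht, hq⟩ := hQ.mem g
  rw [Set.mem_Ici] at ht
  -- The cone(S) part of Q g is a competitor for P; the loss 2tm - t² is at most m², with m = max
  -- ⟪e, g⟫ 0.
  have h1 : ‖g - P g‖ ≤ ‖g - a • s‖ := hP.norm_residual_le g ⟨a, ha, s, hs, 0, rfl, by simp⟩
  have h2 := pow_le_pow_left₀ (norm_nonneg _) h1 2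
  have h3 : g - Q g = (g - a • s) - t • e := by rw [hq]; abel
  have h4 : ⟪g - a • s, e⟫ ≤ max ⟪e, g⟫ 0 := by
    rw [inner_sub_left, real_inner_smul_left, real_inner_comm]
    have := le_max_left ⟪e, g⟫ 0
    have := mul_nonneg ha (hSe s hs)
    linarith
  rw [h3, norm_sub_sq_real (g - a • s), real_inner_smul_right, norm_smul, he, mul_one,
    Real.norm_eq_abs, sq_abs]
  have h5 := mul_le_mul_of_nonneg_left h4 ht
  nlinarith [sq_nonneg (max ⟪e, g⟫ 0 - t)]

lemma exists_l2RecipeObjective_le (hnorm : ∀ x, f₀ x = 0 → x = 0) (hxs : xs ≠ 0)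
    (hne : (subdifferential f₀ xs).Nonempty) (hcompact : IsCompact (subdifferential f₀ xs)) :
    ∃ τ : Fin 2 → ℝ, (∀ i, 0 ≤ τ i) ∧ l2RecipeObjective f₀ xs τ ≤
      statisticalDimension (l2PriorRestrictedCone f₀ xs) +
        (2 * sSup ((fun s ↦ ‖s‖) '' subdifferential f₀ xs) / f₀ (‖xs‖⁻¹ • xs) + 1 / 2) := by
  set S := subdifferential f₀ xs with hS
  set e := ‖xs‖⁻¹ • xs with he
  set R := sSup ((fun s ↦ ‖s‖) '' S) with hRdef
  set c := f₀ e with hc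
  set μ := stdGaussian (EuclideanSpace ℝ (Fin n)) with hμ
  have hnx : 0 < ‖xs‖ := norm_pos_iff.2 hxs
  have hfx : 0 < f₀ xs := (apply_nonneg f₀ xs).lt_of_ne fun h ↦ hxs (hnorm xs h.symm)
  have hen : ‖e‖ = 1 := by rw [he, norm_smul, norm_inv, norm_norm, inv_mul_cancel₀ hnx.ne']
  have hcx : c = ‖xs‖⁻¹ * f₀ xs := by rw [hc, he, map_smul_eq_mul, norm_inv, norm_norm]
  have hc0 : 0 < c := by rw [hcx]; positivity
  have hSe : ∀ s ∈ S, ⟪s, e⟫ = c := fun s hs ↦ by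
    rw [he, real_inner_smul_right, inner_eq_of_mem_subdifferential hs, hcx]
  have hSconv : Convex ℝ S := convex_subdifferential _ _
  have hR : ∀ s ∈ S, ‖s‖ ≤ R := fun s hs ↦
    le_csSup (hcompact.image continuous_norm).bddAbove ⟨s, hs, rfl⟩
  have hR0 : 0 < R := by
    obtain ⟨s, hs⟩ := hne
    have h1 := real_inner_le_norm s e
    rw [hSe s hs, hen, mul_one] at h1
    exact hc0.trans_le (h1.trans (hR s hs))
  have hconeNe : ∀ {T : Set ℝ}, (0 : ℝ) ∈ T → (coneSum S e T).Nonempty := fun {T} hT ↦ by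
    obtain ⟨s, hs⟩ := hne
    exact ⟨0, 0, le_rfl, s, hs, 0, hT, by simp⟩
  obtain ⟨P, hP⟩ := exists_isConvexProj (hconeNe (Set.mem_singleton (0 : ℝ)))
    (isClosed_coneSum hcompact hen hc0 hSe isClosed_singleton (by simp))
    (convex_coneSum hSconv e (convex_singleton (0 : ℝ)))
  obtain ⟨P', hP'⟩ := exists_isConvexProj (hconeNe Set.self_mem_Ici)
    (isClosed_coneSum hcompact hen hc0 hSe isClosed_Ici fun t ht ↦ ht)
    (convex_coneSum hSconv e (convex_Ici (0 : ℝ)))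
  -- Since ⟪s, e⟫ = c on S, pairing with e recovers the dilation factor of P g.
  set a : EuclideanSpace ℝ (Fin n) → ℝ := fun g ↦ c⁻¹ * ⟪P g, e⟫ with ha
  have haP : ∀ g, 0 ≤ a g ∧ ∃ s ∈ S, P g = a g • s := by
    intro g
    obtain ⟨b, hb, s, hs, t, rfl, hp⟩ := hP.mem g
    rw [zero_smul, add_zero] at hp
    have : a g = b := by
      rw [ha]
      simp only
      rw [hp, real_inner_smul_left, hSe s hs, mul_comm b, inv_mul_cancel_left₀ hc0.ne']
    rw [this]
    exact ⟨hb, s, hs, hp⟩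
  have haLip : LipschitzWith (Real.toNNReal c⁻¹) a := by
    refine LipschitzWith.of_dist_le_mul fun g h ↦ ?_
    rw [Real.coe_toNNReal _ (inv_pos.2 hc0).le, Real.dist_eq, dist_eq_norm]
    simp only [ha]
    rw [← mul_sub, ← inner_sub_left, abs_mul, abs_of_pos (inv_pos.2 hc0)]
    refine mul_le_mul_of_nonneg_left ?_ (inv_pos.2 hc0).le
    refine (abs_real_inner_le_norm _ _).trans ?_
    rw [hen, mul_one]
    exact hP.norm_sub_le g h
  set a₀ := ∫ g, a g ∂μ with ha₀
  have ha₀0 : 0 ≤ a₀ := integral_nonneg fun g ↦ (haP g).1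
  obtain ⟨Q, hQ⟩ := exists_isConvexProj (hne.smul_set (a := a₀)) (hcompact.smul a₀).isClosed
    (hSconv.smul a₀)
  set σ : EuclideanSpace ℝ (Fin n) → ℝ := fun g ↦ supportFun S (g - Q g) with hσ
  have hσLip : LipschitzWith (Real.toNNReal R) σ := by
    refine LipschitzWith.of_le_add_mul _ fun g h ↦ ?_
    rw [Real.coe_toNNReal _ hR0.le, dist_eq_norm]
    refine (supportFun_sub_le hcompact hne hR (g - Q g) (h - Q h)).trans ?_
    gcongr
    exact hQ.norm_residual_sub_le g h
  have hcov := integral_mul_sub_integral_stdGaussian_le hσLip haLip (Real.toNNReal_pos.2 hR0)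
    (Real.toNNReal_pos.2 (inv_pos.2 hc0))
  rw [Real.coe_toNNReal _ hR0.le, Real.coe_toNNReal _ (inv_pos.2 hc0).le, ← hμ, ← ha₀] at hcov
  have hL1 : Integrable (fun g ↦ coneSup (l2PriorRestrictedCone f₀ xs) g ^ 2) μ :=
    (lipschitzWith_coneSup (zero_mem_l2PriorRestrictedCone f₀ xs)).integrable_sq_stdGaussian
  have hL2 : Integrable (fun g ↦ max ⟪e, g⟫ 0 ^ 2) μ := integrable_max_inner_sq_stdGaussian e
  have hL3 : Integrable (fun g ↦ σ g * (a g - a₀)) μ :=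
    hσLip.memLp_two_stdGaussian.integrable_mul (haLip.memLp_two_stdGaussian.sub (memLp_const a₀))
  have hL12 : Integrable (fun g ↦ coneSup (l2PriorRestrictedCone f₀ xs) g ^ 2 +
    max ⟪e, g⟫ 0 ^ 2) μ := hL1.add hL2
  refine ⟨![a₀, 0], by simp [Fin.forall_fin_two, ha₀0], ?_⟩
  calc l2RecipeObjective f₀ xs ![a₀, 0]
      ≤ ∫ g, (coneSup (l2PriorRestrictedCone f₀ xs) g ^ 2 + max ⟪e, g⟫ 0 ^ 2 +
          2 * (σ g * (a g - a₀))) ∂μ := by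
        refine integral_mono (Metric.lipschitz_infDist_pt _).integrable_sq_stdGaussian
          (hL12.add (hL3.const_mul 2)) fun g ↦ ?_
        obtain ⟨hag, s, hs, hPs⟩ := haP g
        have h1 : Metric.infDist g (a₀ • S + {(0 : ℝ) • e}) ≤ ‖g - Q g‖ := by
          rw [← dist_eq_norm]
          exact Metric.infDist_le_dist_of_mem ⟨Q g, hQ.mem g, _, rfl, by simp⟩
        have h2 := pow_le_pow_left₀ Metric.infDist_nonneg h1 2
        have h3 := norm_residual_sq_le_of_isConvexProj_smul hcompact hne hQ g hag hs
        rw [← hPs] at h3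
        have h4 := norm_residual_sq_le_add_max_inner_sq hen
          (fun s hs ↦ (hSe s hs).symm ▸ hc0.le) hP hP' g
        have h5 := pow_le_pow_left₀ (norm_nonneg _) (norm_residual_le_coneSup hfx hP' g) 2
        change Metric.infDist g (a₀ • S + {(0 : ℝ) • e}) ^ 2 ≤ _
        simp only [hσ]
        linarith
    _ = statisticalDimension (l2PriorRestrictedCone f₀ xs) + 1 / 2 +
          2 * ∫ g, σ g * (a g - a₀) ∂μ := by
        rw [integral_add hL12 (hL3.const_mul 2), integral_add hL1 hL2, integral_const_mul,
          statisticalDimension_eq, integral_max_inner_sq_stdGaussian hen]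
    _ ≤ statisticalDimension (l2PriorRestrictedCone f₀ xs) + (2 * R / c + 1 / 2) := by
        rw [← div_eq_mul_inv] at hcov
        have h6 : 2 * R / c = 2 * (R / c) := mul_div_assoc _ _ _
        linarith

end Recipe

theorem mainTheorem7 {n : ℕ} (f₀ : Seminorm ℝ (EuclideanSpace ℝ (Fin n)))
    (hnorm : ∀ x, f₀ x = 0 → x = 0) (xs : EuclideanSpace ℝ (Fin n))
    (hne : (subdifferential f₀ xs).Nonempty) (hcompact : IsCompact (subdifferential f₀ xs))
    (hzero : (0 : EuclideanSpace ℝ (Fin n)) ∉ subdifferential f₀ xs)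
    (hri : (intrinsicInterior ℝ (descentCone f₀ xs) ∩
      intrinsicInterior ℝ (descentCone (fun x => ‖x‖) xs)).Nonempty) :
    0 ≤ sInf (l2RecipeObjective f₀ xs '' {τ : Fin 2 → ℝ | ∀ i, 0 ≤ τ i}) -
        statisticalDimension (l2PriorRestrictedCone f₀ xs) ∧
      sInf (l2RecipeObjective f₀ xs '' {τ : Fin 2 → ℝ | ∀ i, 0 ≤ τ i}) -
          statisticalDimension (l2PriorRestrictedCone f₀ xs) ≤
        2 * sSup ((fun s => ‖s‖) '' subdifferential f₀ xs) / f₀ (‖xs‖⁻¹ • xs) + 1 / 2 := by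
  have hxs : xs ≠ 0 := by
    rintro rfl
    exact hzero fun t ↦ by simp
  have hset : (l2RecipeObjective f₀ xs '' {τ : Fin 2 → ℝ | ∀ i, 0 ≤ τ i}).Nonempty :=
    ⟨_, 0, fun _ ↦ le_rfl, rfl⟩
  have hlow : ∀ y ∈ l2RecipeObjective f₀ xs '' {τ : Fin 2 → ℝ | ∀ i, 0 ≤ τ i},
      statisticalDimension (l2PriorRestrictedCone f₀ xs) ≤ y := by
    rintro _ ⟨τ, hτ, rfl⟩
    exact statisticalDimension_le_l2RecipeObjective hne hτ
  obtain ⟨τ, hτ, hle⟩ := exists_l2RecipeObjective_le hnorm hxs hne hcompact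
  have hup := csInf_le ⟨_, hlow⟩ ⟨τ, hτ, rfl⟩
  exact ⟨sub_nonneg.2 (le_csInf hset hlow), by linarith⟩
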